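/- Let $n\ge 3$ and $k\ge 0$ be integers. The crown $S_n^k$ is the poset on $\{a_1,\dots,a_{n+k}\}\cup\{b_1,\dots,b_{n+k}\}$, with indices read modulo $n+k$, in which the only strict relations are $a_i<b_j$ for $j\notin\{i,i+1,\dots,i+k\}$. A critical pair of a poset is a pair $(x,y)$ of incomparable elements such that $z<x$ implies $z<y$ and $w>y$ implies $w>x$; the critical pairs of $S_n^k$ are the pairs $(a_i,b_j)$ with $j\in\{i,\dots,i+k\}$. Let $G_n^k$ be the graph on the critical pairs of $S_n^k$ in which $(x,y)$ and $(x',y')$ are adjacent if and only if $x<y'$ and $x'<y$. A set $S$ of critical pairs is reversible if some linear extension $L$ of $S_n^k$ has $x>y$ in $L$ for all $(x,y)\in S$. Let $\tau_j$ ($j\in\mathbb Z/(n+k)$) and $\phi$ be the automorphisms of $S_n^k$ given by $\tau_j(a_i)=a_{i+j}$, $\tau_j(b_i)=b_{i+j}$ and $\phi(a_i)=a_{-i}$, $\phi(b_i)=b_{k-i}$; they act on critical pairs coordinatewise. Suppose that $k<n\le 2k$. Then the following hold. 1. Every independent, non-reversible set $S$ in $G_n^k$ satisfies $$|S|\le 2+\frac{(2k+2-n)(2k+1-n)}{2}.$$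 2. The set $$D=\{(a_i,b_j):1\le i\le j\le 2k+1-n\}\cup\{(a_{k+1},b_{k+1}),(a_{2k+1},b_{2k+1})\}$$ is independent and non-reversible in $G_n^k$, and attains equality in this bound. 3. If $(n,k)\ne(3,2)$, then every independent, non-reversible set in $G_n^k$ that attains equality is $\tau_j(D)$ or $\tau_j(\phi(D))$ for some $j$. -/

import Mathlib

/-- `(x, y)` is a critical pair of the poset `P`: `x` and `y` are incomparable, everything
below `x` is below `y`, and everything above `y` is above `x`. -/
def IsCriticalPair {P : Type*} [PartialOrder P] (x y : P) : Prop :=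
  IncompRel (· ≤ ·) x y ∧ (∀ z, z < x → z < y) ∧ (∀ w, y < w → x < w)

/-- The set `Crit(P)` of critical pairs, as a type. -/
abbrev CritPair (P : Type*) [PartialOrder P] : Type _ :=
  {p : P × P // IsCriticalPair p.1 p.2}

/-- A set `R` of pairs is reversible if some linear extension `L` of `P` has `x > y` in `L`
for all `(x, y) ∈ R`. -/
def IsReversible {P : Type*} [PartialOrder P] (R : Set (P × P)) : Prop :=
  ∃ L : LinearOrder P, (∀ x y : P, x ≤ y → L.le x y) ∧ ∀ p ∈ R, L.lt p.2 p.1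

/-- An automorphism of a poset preserves critical pairs. -/
theorem IsCriticalPair.map {P : Type*} [PartialOrder P] (f : P ≃o P) {x y : P}
    (h : IsCriticalPair x y) : IsCriticalPair (f x) (f y) := by
  obtain ⟨⟨h₁, h₂⟩, h₃, h₄⟩ := h
  refine ⟨⟨?_, ?_⟩, fun z hz => ?_, fun w hw => ?_⟩
  · simpa using h₁
  · simpa using h₂
  · exact f.symm_apply_lt.1 (h₃ _ (f.symm_apply_lt.2 hz))
  · exact f.lt_symm_apply.1 (h₄ _ (f.lt_symm_apply.2 hw))

/-- The action `(x, y) ↦ (f x, f y)` of an automorphism of a poset on its critical pairs. -/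
def CritPair.map {P : Type*} [PartialOrder P] (f : P ≃o P) (p : CritPair P) : CritPair P :=
  ⟨(f p.1.1, f p.1.2), p.2.map f⟩

/-- The ground set of the crown `S_n^k`: elements `a_i` and `b_i`, where the index `i` is
read cyclically modulo `n + k`. -/
inductive Crown (n k : ℕ) : Type
  | a (i : ZMod (n + k)) : Crown n k
  | b (i : ZMod (n + k)) : Crown n k

namespace Crown

/-- `j` belongs to the cyclic interval `{i, i + 1, …, i + k}`. -/
def InInterval (n k : ℕ) (i j : ZMod (n + k)) : Prop :=
  ∃ t : ℕ, t ≤ k ∧ j = i + (t : ZMod (n + k))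

/-- The order of the crown: besides equalities, `a_i ≤ b_j` exactly when `j` is not in the
cyclic interval `{i, i + 1, …, i + k}`. -/
protected def le {n k : ℕ} : Crown n k → Crown n k → Prop
  | a i, a j => i = j
  | b i, b j => i = j
  | a i, b j => ¬ InInterval n k i j
  | b _, a _ => False

instance (n k : ℕ) : PartialOrder (Crown n k) where
  le := Crown.le
  le_refl x := by cases x <;> simp [Crown.le]
  le_trans x y z := by cases x <;> cases y <;> cases z <;> simp [Crown.le] <;> grind
  le_antisymm x y := by cases x <;> cases y <;> simp +contextual [Crown.le]

/-- The rotation `τ_j`: `a_i ↦ a_{i+j}`, `b_i ↦ b_{i+j}`. -/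
def rotation {n k : ℕ} (j : ZMod (n + k)) : Crown n k ≃o Crown n k where
  toFun
    | a i => a (i + j)
    | b i => b (i + j)
  invFun
    | a i => a (i - j)
    | b i => b (i - j)
  left_inv x := by cases x <;> simp
  right_inv x := by cases x <;> simp
  map_rel_iff' {x y} := by
    cases x with
    | a i =>
      cases y with
      | a i' => exact add_left_inj j
      | b i' =>
        refine not_congr (exists_congr fun t => and_congr_right fun _ => ?_)
        rw [add_right_comm, add_left_inj]
    | b i =>
      cases y with
      | a i' => exact Iff.rfl
      | b i' => exact add_left_inj j

/-- The reflection `φ`: `a_i ↦ a_{-i}`, `b_i ↦ b_{k-i}`. -/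
def reflection {n k : ℕ} : Crown n k ≃o Crown n k where
  toFun
    | a i => a (-i)
    | b i => b ((k : ZMod (n + k)) - i)
  invFun
    | a i => a (-i)
    | b i => b ((k : ZMod (n + k)) - i)
  left_inv x := by cases x <;> simp
  right_inv x := by cases x <;> simp
  map_rel_iff' {x y} := by
    cases x with
    | a i =>
      cases y with
      | a j => exact neg_inj
      | b j =>
        refine not_congr ⟨?_, ?_⟩
        · rintro ⟨t, ht, h⟩
          refine ⟨k - t, Nat.sub_le _ _, ?_⟩
          rw [Nat.cast_sub ht]
          linear_combination -h
        · rintro ⟨t, ht, h⟩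
          refine ⟨k - t, Nat.sub_le _ _, ?_⟩
          rw [Nat.cast_sub ht]
          linear_combination -h
    | b i =>
      cases y with
      | a j => exact Iff.rfl
      | b j => exact sub_right_inj

/-- The graph `G_n^k` of critical pairs of the crown `S_n^k`: the pairs `(x, y)` and `(x', y')`
are adjacent iff `x < y'` and `x' < y`. -/
def graph (n k : ℕ) : SimpleGraph (CritPair (Crown n k)) where
  Adj p q := p.1.1 < q.1.2 ∧ q.1.1 < p.1.2
  symm := ⟨fun _ _ h => ⟨h.2, h.1⟩⟩
  loopless := ⟨fun p h => p.2.1.1 h.1.le⟩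

/-- An independent set of `G_n^k` that is not reversible. -/
def IsINR {n k : ℕ} (S : Set (CritPair (Crown n k))) : Prop :=
  (graph n k).IsIndepSet S ∧ ¬ IsReversible (Subtype.val '' S)

/-- The down set generated by pairs `(a_p, b_q)`, `(p, q) ∈ C`, for inclusion of clockwise arcs:
all `(a_i, b_j)` such that for some `(p, q) ∈ C`, going clockwise around the circle `ℤ/(n+k)`
from `p` to the first visit of `q`, one meets `i` and then (or simultaneously) `j`. -/
def downSet {n k : ℕ} (C : Set (ZMod (n + k) × ZMod (n + k))) : Set (CritPair (Crown n k)) :=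
  {v | ∃ i j : ZMod (n + k), v.1 = (a i, b j) ∧
    ∃ c ∈ C, (i - c.1).val ≤ (j - c.1).val ∧ (j - c.1).val ≤ (c.2 - c.1).val}

/-- The down set generated by `(a_1, b_{2k+1-n})`, `(a_{k+1}, b_{k+1})`, `(a_{2k+1}, b_{2k+1})`
(used only for `n ≤ 2k`, so that the subtraction is not truncated). -/
def extremalSet (n k : ℕ) : Set (CritPair (Crown n k)) :=
  downSet {(1, ((2 * k + 1 - n : ℕ) : ZMod (n + k))),
    (((k + 1 : ℕ) : ZMod (n + k)), ((k + 1 : ℕ) : ZMod (n + k))),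
    (((2 * k + 1 : ℕ) : ZMod (n + k)), ((2 * k + 1 : ℕ) : ZMod (n + k)))}

end Crown

/-!
A set of pairs is reversible if and only if it carries no alternating cycle. In an independent set
of `G_n^k` with `k < n`, a shortest alternating cycle has length three: a longer one would contain
three intervals `{i, …, i + k}` with a common point, one of which contains the intersection of the
other two, and this provides a shortcut.

View `(a_i, b_j)` as the clockwise arc `[i, j]` on a circle with `n + k` points, and lift these
arcs to `ℤ`. The three steps of the cycle all go in the same direction, so that, possibly after
the reflection `φ`, the set contains a triangle: three disjoint arcs, with starting points
`x < y < z` at most `k` apart cyclically. If `y - x` and then `z` are as small as possible, each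
arc is contained in `[y, x + k]` or `[z, y + k]`, or starts at `x` and ends by `z - n`, or is an
early arc, starting shortly before `x`. Independence excludes an arc of `[y, x + k]` for every
early arc, and different arcs for different early arcs, so the early arcs and the arcs inside
`[y, x + k]` together are no more than all the arcs contained in `[y, x + k]`. The sum of the
resulting bounds is largest when `z = x + n = y + k`, where it is the bound of the theorem. For an
extremal set, either the longest arc `[y, x + k]` is in the set, or `(n, k) ≠ (3, 2)` forces the
longest early arc `[y - k, x]` to be in it, and in both cases the set is a rotation of `D`.
-/

theorem CritPair.map_injective {P : Type*} [PartialOrder P] (f : P ≃o P) :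
    Function.Injective (CritPair.map f) := fun _ _ h =>
  Subtype.ext (f.injective.prodMap f.injective (congrArg Subtype.val h))

section Reversibility

variable {P : Type*} [PartialOrder P] {R : Set (P × P)}

/-- One step of an alternating cycle of Trotter and Moore: two pairs of `R` such that the first
entry of the one lies below the second entry of the other. -/
def AlternatingStep (R : Set (P × P)) (p q : P × P) : Prop :=
  p ∈ R ∧ q ∈ R ∧ p.1 ≤ q.2

/-- The strict inequalities that every linear extension reversing `R` must satisfy on account of
some nonempty alternating chain of pairs of `R`. -/
def ForcedLT (R : Set (P × P)) (x y : P) : Prop :=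
  ∃ p ∈ R, ∃ q ∈ R, x ≤ p.2 ∧ Relation.ReflTransGen (AlternatingStep R) p q ∧ q.1 ≤ y

theorem ForcedLT.trans_le {x y z : P} (h : ForcedLT R x y) (hyz : y ≤ z) : ForcedLT R x z := by
  obtain ⟨p, hp, q, hq, hxp, hpq, hqy⟩ := h
  exact ⟨p, hp, q, hq, hxp, hpq, hqy.trans hyz⟩

theorem ForcedLT.le_trans {x y z : P} (h : ForcedLT R y z) (hxy : x ≤ y) : ForcedLT R x z := by
  obtain ⟨p, hp, q, hq, hyp, hpq, hqz⟩ := h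
  exact ⟨p, hp, q, hq, hxy.trans hyp, hpq, hqz⟩

theorem ForcedLT.trans {x y z : P} (hxy : ForcedLT R x y) (hyz : ForcedLT R y z) :
    ForcedLT R x z := by
  obtain ⟨p, hp, q, hq, hxp, hpq, hqy⟩ := hxy
  obtain ⟨p', hp', q', hq', hyp', hpq', hqz⟩ := hyz
  exact ⟨p, hp, q', hq', hxp, (hpq.tail ⟨hq, hp', hqy.trans hyp'⟩).trans hpq', hqz⟩

theorem forcedLT_irrefl (h : ∀ p, ¬ Relation.TransGen (AlternatingStep R) p p) (x : P) :
    ¬ ForcedLT R x x := by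
  rintro ⟨p, hp, q, hq, hxp, hpq, hqx⟩
  exact h p (.tail' hpq ⟨hq, hp, hqx.trans hxp⟩)

theorem exists_linearOrder_of_isPartialOrder {α : Type*} (r : α → α → Prop) [IsPartialOrder α r] :
    ∃ L : LinearOrder α, ∀ x y, r x y → L.le x y := by
  let Q : PartialOrder α :=
    { le := r
      le_refl := refl_of r
      le_trans := fun _ _ _ => trans_of r
      le_antisymm := fun _ _ => antisymm_of r }
  exact ⟨(inferInstance : LinearOrder (LinearExtension α)),
    fun _ _ hxy => toLinearExtension.monotone hxy⟩

theorem isPartialOrder_le_or_forcedLT (h : ∀ p, ¬ Relation.TransGen (AlternatingStep R) p p) :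
    IsPartialOrder P fun x y => x ≤ y ∨ ForcedLT R x y where
  refl x := Or.inl le_rfl
  trans := by
    rintro x y z (hxy | hxy) (hyz | hyz)
    · exact Or.inl (hxy.trans hyz)
    · exact Or.inr (hyz.le_trans hxy)
    · exact Or.inr (hxy.trans_le hyz)
    · exact Or.inr (hxy.trans hyz)
  antisymm := by
    rintro x y (hxy | hxy) (hyx | hyx)
    · exact le_antisymm hxy hyx
    · exact absurd (hyx.trans_le hxy) (forcedLT_irrefl h y)
    · exact absurd (hxy.trans_le hyx) (forcedLT_irrefl h x)
    · exact absurd (hxy.trans hyx) (forcedLT_irrefl h x)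

theorem isReversible_of_forall_not_transGen
    (h : ∀ p, ¬ Relation.TransGen (AlternatingStep R) p p) : IsReversible R := by
  have := isPartialOrder_le_or_forcedLT h
  obtain ⟨L, hL⟩ := exists_linearOrder_of_isPartialOrder fun x y => x ≤ y ∨ ForcedLT R x y
  refine ⟨L, fun x y hxy => hL x y (Or.inl hxy), fun p hp => ?_⟩
  have reversed : ForcedLT R p.2 p.1 := ⟨p, hp, p, hp, le_rfl, .refl, le_rfl⟩
  refine (L.toPartialOrder.lt_iff_le_not_ge _ _).2 ⟨hL _ _ (Or.inr reversed), fun hle => ?_⟩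
  have heq : p.1 = p.2 := L.le_antisymm _ _ hle (hL _ _ (Or.inr reversed))
  exact forcedLT_irrefl h p.2 (reversed.trans_le heq.le)

theorem not_transGen_of_isReversible (hR : IsReversible R) (p : P × P) :
    ¬ Relation.TransGen (AlternatingStep R) p p := by
  obtain ⟨L, hL, reversed⟩ := hR
  let := L.toPartialOrder.toPreorder
  have step : ∀ {p q}, AlternatingStep R p q → L.lt p.1 q.1 := fun h =>
    lt_of_le_of_lt (hL _ _ h.2.2) (reversed _ h.2.1)
  intro h
  have : ∀ {q}, Relation.TransGen (AlternatingStep R) p q → L.lt p.1 q.1 := fun h => by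
    induction h with
    | single hpq => exact step hpq
    | tail _ hqr ih => exact lt_trans ih (step hqr)
  exact lt_irrefl _ (this h)

end Reversibility

theorem exists_two_steps_of_transGen {α : Type*} {r : α → α → Prop}
    (shortcut : ∀ {p q s t}, r p q → r q s → r s t → r p s ∨ r q t ∨ r p t) {p q : α}
    (h : Relation.TransGen r p q) : r p q ∨ ∃ s, r p s ∧ r s q := by
  induction h with
  | single hpq => exact Or.inl hpq
  | tail _ hst ih =>
    rcases ih with hps | ⟨u, hpu, hus⟩
    · exact Or.inr ⟨_, hps, hst⟩
    · rcases shortcut hpu hus hst with hps | hut | hpt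
      · exact Or.inr ⟨_, hps, hst⟩
      · exact Or.inr ⟨_, hpu, hut⟩
      · exact Or.inl hpt

section Residues

variable {m : ℕ}

theorem intCast_zmod_eq_iff {i j : ℤ} : (i : ZMod m) = j ↔ ∃ q : ℤ, j = i + q * m := by
  rw [ZMod.intCast_eq_intCast_iff_dvd_sub, dvd_def]
  exact exists_congr fun q => by rw [mul_comm (m : ℤ)]; omega

theorem eq_of_intCast_zmod_eq {i j : ℤ} (h : (i : ZMod m) = j) (hij : i < j + m)
    (hji : j < i + m) : i = j := by
  rw [ZMod.intCast_eq_intCast_iff_dvd_sub] at h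
  have := Int.eq_zero_of_abs_lt_dvd h (by rw [abs_lt]; omega)
  omega

theorem exists_intCast_zmod_eq [NeZero m] (l : ℤ) (x : ZMod m) :
    ∃ i : ℤ, (i : ZMod m) = x ∧ l ≤ i ∧ i < l + m := by
  obtain ⟨j, rfl⟩ := ZMod.intCast_surjective x
  obtain ⟨q, hq, -⟩ := existsUnique_add_zsmul_mem_Ico (a := (m : ℤ))
    (by exact_mod_cast NeZero.pos m) j l
  exact ⟨j + q • m, by simp, hq⟩

theorem val_intCast_sub_intCast [NeZero m] {l i : ℤ} (hli : l ≤ i) (hil : i < l + m) :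
    (((i : ZMod m) - l).val : ℤ) = i - l := by
  rw [← Int.cast_sub, ZMod.val_intCast, Int.emod_eq_of_lt (by omega) (by omega)]

theorem val_sub_le_val_sub_iff [NeZero m] {l u : ℤ} (hlu : l ≤ u) (hul : u < l + m)
    {x y : ZMod m} :
    ((x - l).val ≤ (y - l).val ∧ (y - l).val ≤ ((u : ZMod m) - l).val) ↔
      ∃ i j : ℤ, (i : ZMod m) = x ∧ (j : ZMod m) = y ∧ l ≤ i ∧ i ≤ j ∧ j ≤ u := by
  zify
  rw [val_intCast_sub_intCast hlu hul]
  constructor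
  · intro h
    obtain ⟨i, rfl, hli, hil⟩ := exists_intCast_zmod_eq l x
    obtain ⟨j, rfl, hlj, hjl⟩ := exists_intCast_zmod_eq l y
    rw [val_intCast_sub_intCast hli hil, val_intCast_sub_intCast hlj hjl] at h
    exact ⟨i, j, rfl, rfl, hli, by omega, by omega⟩
  · rintro ⟨i, j, rfl, rfl, hli, hij, hju⟩
    rw [val_intCast_sub_intCast hli (by omega), val_intCast_sub_intCast (by omega) (by omega)]
    omega

end Residues

namespace Crown

/-- The lift to `ℤ` of an independent set of critical pairs: `P i j` says that the pair
`(a_i, b_j)`, thought of as the clockwise arc `[i, j]` on a circle with `n + k` points, belongs to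
the set. The fields `near` and `far` express independence for `a_j` in the interval
`{a_i, …, a_{i+k}}` and beyond it, respectively. -/
structure IsArcFamily (n k : ℤ) (P : ℤ → ℤ → Prop) : Prop where
  le {i j} : P i j → i ≤ j
  periodic {i j} : P (i + (n + k)) (j + (n + k)) ↔ P i j
  near {i i' j j'} : P i i' → P j j' → i < j → j ≤ i + k → j ≤ i' ∨ j' ≤ i + k
  far {i i' j j'} : P i i' → P j j' → i + k < j → ¬ j < i + n

/-- Three pairwise disjoint arcs of the family, starting at `x < y < z`, such that each starting
point is at most `k` after the preceding one on the circle. -/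
structure IsTriangle (n k : ℤ) (P : ℤ → ℤ → Prop) (x y z : ℤ) : Prop where
  exists_arcs : ∃ x' y' z', P x x' ∧ P y y' ∧ P z z' ∧ x' < y ∧ y' < z ∧ z' < x + (n + k)
  le_left_add : y ≤ x + k
  le_mid_add : z ≤ y + k
  add_le_right : x + n ≤ z

/-- A triangle whose first gap `y - x` is as small as possible and whose third vertex is then as
close to the second one as possible. -/
structure IsMinimalTriangle (n k : ℤ) (P : ℤ → ℤ → Prop) (x y z : ℤ) : Prop
    extends IsTriangle n k P x y z where
  sub_le {x' y' z'} : IsTriangle n k P x' y' z' → y - x ≤ y' - x'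
  le_right {z'} : IsTriangle n k P x y z' → z ≤ z'

section ArcFamily

variable {n k : ℤ} {P : ℤ → ℤ → Prop} {x y z : ℤ}

theorem IsArcFamily.add_mul_iff (hP : IsArcFamily n k P) {i j : ℤ} (q : ℤ) :
    P (i + q * (n + k)) (j + q * (n + k)) ↔ P i j := by
  induction q with
  | zero => simp only [zero_mul, add_zero]
  | succ q ih => rw [add_one_mul, ← add_assoc i, ← add_assoc j, hP.periodic, ih]
  | pred q ih => rw [← hP.periodic, sub_one_mul, add_assoc, add_assoc, sub_add_cancel, ih]

theorem IsTriangle.lt_left (hP : IsArcFamily n k P) (h : IsTriangle n k P x y z) : x < y := by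
  obtain ⟨x', -, -, hx, -, -, hxy, -⟩ := h.exists_arcs
  exact (hP.le hx).trans_lt hxy

theorem IsTriangle.lt_right (hP : IsArcFamily n k P) (h : IsTriangle n k P x y z) : y < z := by
  obtain ⟨-, y', -, -, hy, -, -, hyz, -⟩ := h.exists_arcs
  exact (hP.le hy).trans_lt hyz

theorem IsTriangle.rotate (hP : IsArcFamily n k P) (h : IsTriangle n k P x y z) :
    IsTriangle n k P y z (x + (n + k)) := by
  obtain ⟨⟨x', y', z', hx, hy, hz, hxy, hyz, hzx⟩, hxk, hyk, hxn⟩ := h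
  exact ⟨⟨y', z', x' + (n + k), hy, hz, hP.periodic.2 hx, hyz, hzx, by omega⟩,
    by omega, by omega, by omega⟩

theorem IsTriangle.rotate_back (hP : IsArcFamily n k P)
    (h : IsTriangle n k P y z (x + (n + k))) : IsTriangle n k P x y z := by
  obtain ⟨⟨y', z', x', hy, hz, hx, hyz, hzx, hxy⟩, hyk, hzk, hyn⟩ := h
  refine ⟨⟨x' - (n + k), y', z', hP.periodic.1 ?_, hy, hz, ?_⟩, ?_, ?_, ?_⟩
  · rwa [sub_add_cancel]
  all_goals omega

theorem IsTriangle.locate (hP : IsArcFamily n k P) (hkn : k < n) (h : IsTriangle n k P x y z)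
    {w w' : ℤ} (hw : P w w') (hxw : x ≤ w) (hwy : w < y) :
    (w' + n ≤ z ∧ IsTriangle n k P w y z) ∨ (w' ≤ x + k ∧ IsTriangle n k P x w z) := by
  obtain ⟨⟨x', y', z', hx, hy, hz, -, hyz, hzx⟩, hxk, hyk, hxn⟩ := h
  rcases lt_or_ge (w + k) z with hwz | hzw
  · have hnwz : w + n ≤ z := not_lt.1 (hP.far hw hz hwz)
    have hw'z := hP.near hz (hP.periodic.2 hw) (by omega) (by omega)
    exact Or.inl ⟨by omega, ⟨w', y', z', hw, hy, hz, by omega, hyz, by omega⟩, by omega, hyk, hnwz⟩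
  · have hx'z := hP.near hz (hP.periodic.2 hx) (by omega) (by omega)
    have hw'x := hP.near hx hw (by omega) (by omega)
    exact Or.inr ⟨by omega, ⟨x', w', z', hx, hw, hz, by omega, by omega, hzx⟩,
      by omega, hzw, hxn⟩

theorem exists_isMinimalTriangle (hP : IsArcFamily n k P) (h : IsTriangle n k P x y z) :
    ∃ x y z, IsMinimalTriangle n k P x y z := by
  obtain ⟨d, ⟨x, y, ⟨z₀, hz₀⟩, rfl⟩, hd⟩ := Int.exists_least_of_bdd
    (P := fun d => ∃ x y, (∃ z, IsTriangle n k P x y z) ∧ d = y - x)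
    ⟨0, by rintro _ ⟨x, y, ⟨z, hz⟩, rfl⟩; exact (sub_pos.2 (hz.lt_left hP)).le⟩
    ⟨_, x, y, ⟨z, h⟩, rfl⟩
  obtain ⟨z, hz, hz_le⟩ := Int.exists_least_of_bdd (P := fun z => IsTriangle n k P x y z)
    ⟨y, fun z hz => (hz.lt_right hP).le⟩ ⟨z₀, hz₀⟩
  exact ⟨x, y, z, ⟨hz, fun h' => hd _ ⟨_, _, ⟨_, h'⟩, rfl⟩, hz_le _⟩⟩

theorem IsMinimalTriangle.position (hP : IsArcFamily n k P) (hkn : k < n)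
    (h : IsMinimalTriangle n k P x y z) {w w' : ℤ} (hw : P w w') (hxw : x ≤ w)
    (hwx : w < x + (n + k)) :
    (w = x ∧ w' + n ≤ z) ∨ (y ≤ w ∧ w' ≤ x + k) ∨ (z ≤ w ∧ w' ≤ y + k) ∨
      (y - x ≤ w - z ∧ w' ≤ z + k) := by
  have hxyz := h.toIsTriangle
  have hyzx := hxyz.rotate hP
  rcases lt_or_ge w y with hwy | hyw
  · rcases hxyz.locate hP hkn hw hxw hwy with ⟨hw'z, hwyz⟩ | ⟨-, hxwz⟩
    · have := h.sub_le hwyz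
      omega
    · have := h.sub_le hxwz
      omega
  rcases lt_or_ge w z with hwz | hzw
  · rcases hyzx.locate hP hkn hw hyw hwz with ⟨hw'x, -⟩ | ⟨-, hywx⟩
    · omega
    · have := h.le_right (hywx.rotate_back hP)
      omega
  · rcases (hyzx.rotate hP).locate hP hkn hw hzw hwx with ⟨hw'y, -⟩ | ⟨hw'z, hzwy⟩
    · omega
    · have := h.sub_le hzwy
      omega

theorem IsArcFamily.false_of_conflict (hP : IsArcFamily n k P) (hkn : k < n) {v u w w' : ℤ}
    (hv : P v u) (hw : P w w') (hyv : y ≤ v + k) (huy : u + n ≤ y + k) (hyw : y ≤ w)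
    (hwy : w' < y + k) (hvw : v + k < w') (hwu : w < u + n) : False := by
  rcases le_or_gt w (v + k) with hwv | hvw
  · have := hP.near hv hw (by omega) hwv
    omega
  · have hvnw : v + n ≤ w := not_lt.1 (hP.far hv hw hvw)
    have := hP.near hw (hP.periodic.2 hv) (by omega) (by omega)
    omega

end ArcFamily

section Counting

/-- The arcs contained in `[l, u]`. -/
noncomputable def subarcs (l u : ℤ) : Finset (ℤ × ℤ) :=
  (Finset.Icc l u ×ˢ Finset.Icc l u).filter fun p => p.1 ≤ p.2

theorem mem_subarcs {l u : ℤ} {p : ℤ × ℤ} : p ∈ subarcs l u ↔ l ≤ p.1 ∧ p.1 ≤ p.2 ∧ p.2 ≤ u := by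
  simp only [subarcs, Finset.mem_filter, Finset.mem_product, Finset.mem_Icc]
  omega

theorem subarcs_self (l : ℤ) : subarcs l l = {(l, l)} := by
  ext p
  rw [mem_subarcs, Finset.mem_singleton, Prod.ext_iff]
  dsimp only
  omega

theorem subarcs_add_one (l u : ℤ) :
    subarcs l (u + 1) = subarcs l u ∪ Finset.Icc l (u + 1) ×ˢ {u + 1} := by
  ext p
  simp only [mem_subarcs, Finset.mem_union, Finset.mem_product, Finset.mem_Icc,
    Finset.mem_singleton]
  omega

theorem two_mul_card_subarcs {l u : ℤ} (h : l ≤ u + 1) :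
    2 * ((subarcs l u).card : ℤ) = (u - l + 1) * (u - l + 2) := by
  replace h : l - 1 ≤ u := by omega
  induction u, h using Int.leInduction with
  | base => simp [subarcs]
  | succ u hu ih =>
    have hdisj : Disjoint (subarcs l u) (Finset.Icc l (u + 1) ×ˢ {u + 1}) := by
      rw [Finset.disjoint_left]
      intro p
      simp only [mem_subarcs, Finset.mem_product, Finset.mem_singleton]
      omega
    rw [subarcs_add_one, Finset.card_union_of_disjoint hdisj, Finset.card_product,
      Finset.card_singleton, mul_one, Nat.cast_add, Int.card_Icc_of_le _ _ (by omega)]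
    linear_combination ih

/-- The arcs from `subarcs y (y + 2 * k - n)`, a down set, together with two further points: for
`y = 1` these are the arcs of the critical pairs in the set `D`. -/
noncomputable def extremalArcs (n k y : ℤ) : Finset (ℤ × ℤ) :=
  subarcs y (y + 2 * k - n) ∪ {(y + k, y + k), (y + 2 * k, y + 2 * k)}

theorem mem_extremalArcs {n k y : ℤ} {p : ℤ × ℤ} : p ∈ extremalArcs n k y ↔
    p ∈ subarcs y (y + 2 * k - n) ∨ p = (y + k, y + k) ∨ p = (y + 2 * k, y + 2 * k) := by
  rw [extremalArcs, Finset.mem_union, Finset.mem_insert, Finset.mem_singleton]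

theorem two_mul_card_extremalArcs {n k : ℤ} (hkn : k < n) (hnk : n ≤ 2 * k) (y : ℤ) :
    2 * ((extremalArcs n k y).card : ℤ) = 4 + (2 * k - n + 1) * (2 * k - n + 2) := by
  have hdisj : Disjoint (subarcs y (y + 2 * k - n))
      {(y + k, y + k), (y + 2 * k, y + 2 * k)} := by
    simp only [Finset.disjoint_insert_right, Finset.disjoint_singleton_right, mem_subarcs]
    omega
  have hne : (y + k, y + k) ≠ (y + 2 * k, y + 2 * k) := by
    rw [Ne, Prod.mk.injEq]
    omega
  rw [extremalArcs, Finset.card_union_of_disjoint hdisj, Finset.card_pair hne, Nat.cast_add,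
    mul_add, two_mul_card_subarcs (by omega)]
  push_cast
  ring

open Classical in
/-- The arcs of the family `P` contained in `[l, u]`. -/
noncomputable def arcsIn (P : ℤ → ℤ → Prop) (l u : ℤ) : Finset (ℤ × ℤ) :=
  (subarcs l u).filter fun p => P p.1 p.2

/-- The arcs of the family `P` that start before the first vertex `x` of the minimal triangle
`x < y < z`, but too late to be contained in the window between the preceding two vertices. -/
noncomputable def earlyArcs (n k : ℤ) (P : ℤ → ℤ → Prop) (x y z : ℤ) : Finset (ℤ × ℤ) :=
  (arcsIn P (y + z - x - (n + k)) (z - n)).filter fun p => p.1 < x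

/-- An arc of `[y, x + k]` in conflict with the arc `p`, chosen so that different early arcs `p`
get different conflicting arcs. -/
def conflictingArc (k x y : ℤ) (p : ℤ × ℤ) : ℤ × ℤ :=
  if p.2 < x then (p.1 + k, p.2 + k + 1)
  else if p.2 = x then (p.1 + k + 1, p.1 + k + 1)
  else (y + p.2 - x - 1, p.1 + k + 1)

/-- A small set of arcs containing a translate of each arc of the family `P`, when `x < y < z`
is a minimal triangle. -/
noncomputable def representatives (n k : ℤ) (P : ℤ → ℤ → Prop) (x y z : ℤ) : Finset (ℤ × ℤ) :=
  earlyArcs n k P x y z ∪ arcsIn P y (x + k) ∪ subarcs z (y + k) ∪ {x} ×ˢ Finset.Icc x (z - n)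

/-- Every arc of the family `P` has a translate by a multiple of `n + k` in `A`. -/
def IsCoveredBy (n k : ℤ) (P : ℤ → ℤ → Prop) (A : Finset (ℤ × ℤ)) : Prop :=
  ∀ i j, P i j → ∃ q : ℤ, (i + q * (n + k), j + q * (n + k)) ∈ A

variable {n k : ℤ} {P : ℤ → ℤ → Prop} {x y z : ℤ}

theorem mem_arcsIn {l u : ℤ} {p : ℤ × ℤ} :
    p ∈ arcsIn P l u ↔ p ∈ subarcs l u ∧ P p.1 p.2 := by
  classical rw [arcsIn, Finset.mem_filter]

theorem mem_earlyArcs {p : ℤ × ℤ} : p ∈ earlyArcs n k P x y z ↔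
    p ∈ subarcs (y + z - x - (n + k)) (z - n) ∧ P p.1 p.2 ∧ p.1 < x := by
  rw [earlyArcs, Finset.mem_filter, mem_arcsIn, and_assoc]

theorem mem_representatives {p : ℤ × ℤ} : p ∈ representatives n k P x y z ↔
    p ∈ earlyArcs n k P x y z ∨ p ∈ arcsIn P y (x + k) ∨ p ∈ subarcs z (y + k) ∨
      p.1 = x ∧ x ≤ p.2 ∧ p.2 ≤ z - n := by
  simp only [representatives, Finset.mem_union, Finset.mem_product, Finset.mem_singleton,
    Finset.mem_Icc, or_assoc]

theorem conflictingArc_injOn : Set.InjOn (conflictingArc k x y) (earlyArcs n k P x y z) := by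
  rintro ⟨v, u⟩ h ⟨v', u'⟩ h' heq
  rw [Finset.mem_coe, mem_earlyArcs, mem_subarcs] at h h'
  simp only [conflictingArc] at h h' heq
  rw [Prod.mk.injEq]
  split_ifs at heq <;> rw [Prod.mk.injEq] at heq <;> omega

theorem IsTriangle.conflictingArc_mem_subarcs (h : IsTriangle n k P x y z) {p : ℤ × ℤ}
    (hp : p ∈ earlyArcs n k P x y z) : conflictingArc k x y p ∈ subarcs y (x + k) := by
  have := h.add_le_right
  rw [mem_earlyArcs, mem_subarcs] at hp
  rw [mem_subarcs, conflictingArc]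
  split_ifs <;> simp only <;> omega

theorem IsTriangle.disjoint_arcsIn_image_conflictingArc (hP : IsArcFamily n k P) (hkn : k < n)
    (h : IsTriangle n k P x y z) :
    Disjoint (arcsIn P y (x + k)) ((earlyArcs n k P x y z).image (conflictingArc k x y)) := by
  rw [Finset.disjoint_right]
  intro _ hp harc
  obtain ⟨⟨v, u⟩, hvu, rfl⟩ := Finset.mem_image.1 hp
  obtain ⟨hsub, hPvu, hvx⟩ := mem_earlyArcs.1 hvu
  obtain ⟨-, hxk, hyk, hxn⟩ := h
  rw [mem_subarcs] at hsub
  rw [mem_arcsIn, mem_subarcs] at harc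
  refine hP.false_of_conflict hkn (y := y) hPvu harc.2 ?_ ?_ ?_ ?_ ?_ ?_ <;>
    replace harc := harc.1 <;> simp only [conflictingArc] at * <;> split_ifs at * <;>
    simp only at * <;> omega

theorem IsTriangle.card_arcsIn_union_image (hP : IsArcFamily n k P) (hkn : k < n)
    (h : IsTriangle n k P x y z) :
    (arcsIn P y (x + k) ∪ (earlyArcs n k P x y z).image (conflictingArc k x y)).card =
      (arcsIn P y (x + k)).card + (earlyArcs n k P x y z).card := by
  rw [Finset.card_union_of_disjoint (h.disjoint_arcsIn_image_conflictingArc hP hkn),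
    Finset.card_image_of_injOn conflictingArc_injOn]

theorem IsTriangle.arcsIn_union_image_subset (h : IsTriangle n k P x y z) :
    arcsIn P y (x + k) ∪ (earlyArcs n k P x y z).image (conflictingArc k x y) ⊆
      subarcs y (x + k) :=
  Finset.union_subset (fun _ hp => (mem_arcsIn.1 hp).1)
    (Finset.image_subset_iff.2 fun _ => h.conflictingArc_mem_subarcs)

theorem IsMinimalTriangle.isCoveredBy_representatives (hP : IsArcFamily n k P) (hkn : k < n)
    (h : IsMinimalTriangle n k P x y z) : IsCoveredBy n k P (representatives n k P x y z) := by
  intro i j hij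
  have hxy := h.lt_left hP
  have hxk := h.le_left_add
  obtain ⟨q, ⟨hxi, hix⟩, -⟩ := existsUnique_add_zsmul_mem_Ico (a := n + k) (by omega) i x
  rw [smul_eq_mul] at hxi hix
  have hPq := (hP.add_mul_iff q).2 hij
  have hle := hP.le hPq
  rcases h.position hP hkn hPq hxi hix with hx | hy | hz | hearly
  · exact ⟨q, mem_representatives.2 (Or.inr (Or.inr (Or.inr (by simp only; omega))))⟩
  · exact ⟨q, mem_representatives.2 (Or.inr (Or.inl
      (mem_arcsIn.2 ⟨mem_subarcs.2 ⟨hy.1, hle, hy.2⟩, hPq⟩)))⟩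
  · exact ⟨q, mem_representatives.2 (Or.inr (Or.inr (Or.inl
      (mem_subarcs.2 ⟨hz.1, hle, hz.2⟩))))⟩
  · refine ⟨q - 1, mem_representatives.2 (Or.inl (mem_earlyArcs.2
      ⟨mem_subarcs.2 ?_, (hP.add_mul_iff (q - 1)).2 hij, ?_⟩))⟩ <;>
      simp only [sub_one_mul] <;> omega

theorem card_representatives_le : (representatives n k P x y z).card ≤
    (arcsIn P y (x + k)).card + (earlyArcs n k P x y z).card + (subarcs z (y + k)).card +
      (z - n + 1 - x).toNat := by
  calc (representatives n k P x y z).card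
    _ ≤ (earlyArcs n k P x y z).card + (arcsIn P y (x + k)).card + (subarcs z (y + k)).card +
        ({x} ×ˢ Finset.Icc x (z - n) : Finset (ℤ × ℤ)).card := by
      refine (Finset.card_union_le _ _).trans (Nat.add_le_add_right ?_ _)
      refine (Finset.card_union_le _ _).trans (Nat.add_le_add_right ?_ _)
      exact Finset.card_union_le _ _
    _ = _ := by
      rw [Finset.card_product, Finset.card_singleton, one_mul, Int.card_Icc]
      ring

theorem IsTriangle.two_mul_card_representatives_le_add (h : IsTriangle n k P x y z) :
    2 * ((representatives n k P x y z).card : ℤ) ≤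
      2 * ((arcsIn P y (x + k)).card + (earlyArcs n k P x y z).card) +
        (y + k - z + 1) * (y + k - z + 2) + 2 * (z - n - x + 1) := by
  have hcard := card_representatives_le (n := n) (k := k) (P := P) (x := x) (y := y) (z := z)
  have hz := two_mul_card_subarcs (l := z) (u := y + k) (by have := h.le_mid_add; omega)
  have := h.add_le_right
  omega

theorem IsTriangle.two_mul_card_arcsIn_add_card_earlyArcs_le (hP : IsArcFamily n k P)
    (hkn : k < n) (h : IsTriangle n k P x y z) :
    2 * (((arcsIn P y (x + k)).card : ℤ) + (earlyArcs n k P x y z).card) ≤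
      (x + k - y + 1) * (x + k - y + 2) := by
  rw [← two_mul_card_subarcs (by have := h.le_left_add; omega), ← Nat.cast_add,
    ← h.card_arcsIn_union_image hP hkn]
  exact_mod_cast Nat.mul_le_mul_left 2 (Finset.card_le_card h.arcsIn_union_image_subset)

theorem IsMinimalTriangle.two_mul_card_representatives_le (hP : IsArcFamily n k P) (hkn : k < n)
    (h : IsMinimalTriangle n k P x y z) :
    2 * ((representatives n k P x y z).card : ℤ) ≤ 4 + (2 * k - n + 1) * (2 * k - n + 2) := by
  have hcard := h.two_mul_card_representatives_le_add
  have hearly := h.two_mul_card_arcsIn_add_card_earlyArcs_le hP hkn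
  have h₀ := sub_nonneg.2 h.le_left_add
  have h₁ := sub_nonneg.2 h.le_mid_add
  have h₂ := sub_nonneg.2 h.add_le_right
  nlinarith [mul_nonneg h₀ h₁, mul_nonneg h₀ h₂, mul_nonneg h₁ h₂]

theorem IsMinimalTriangle.eq_of_two_mul_card_representatives_eq (hP : IsArcFamily n k P)
    (hkn : k < n) (h : IsMinimalTriangle n k P x y z)
    (heq : 2 * ((representatives n k P x y z).card : ℤ) =
      4 + (2 * k - n + 1) * (2 * k - n + 2)) :
    z = x + n ∧ z = y + k ∧
      arcsIn P y (x + k) ∪ (earlyArcs n k P x y z).image (conflictingArc k x y) =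
        subarcs y (x + k) := by
  have hcard := h.two_mul_card_representatives_le_add
  have hearly := h.two_mul_card_arcsIn_add_card_earlyArcs_le hP hkn
  have h₀ := sub_nonneg.2 h.le_left_add
  have h₁ := sub_nonneg.2 h.le_mid_add
  have h₂ := sub_nonneg.2 (le_sub_iff_add_le'.2 h.add_le_right)
  have h₁₀ : y + k - z ≤ x + k - y := by
    have := h.sub_le (h.rotate hP)
    omega
  have hdefect : 2 * ((x + k - y) * (y + k - z) + (x + k - y) * (z - n - x) +
      (y + k - z) * (z - n - x)) + (z - n - x) * (z - n - x + 1) ≤ 0 := by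
    linear_combination hcard + hearly - heq
  have hz : z - n - x = 0 := by
    nlinarith [mul_nonneg h₀ h₁, mul_nonneg h₀ h₂, mul_nonneg h₁ h₂]
  have hy : y + k - z = 0 := by
    rw [hz] at hdefect
    nlinarith
  refine ⟨by omega, by omega, Finset.eq_of_subset_of_card_le h.arcsIn_union_image_subset ?_⟩
  have hfull := two_mul_card_subarcs (l := y) (u := x + k) (by omega)
  rw [h.card_arcsIn_union_image hP hkn]
  zify
  rw [hz, hy] at hcard
  rw [show 2 * k - n = x + k - y by omega] at heq
  linarith

theorem IsMinimalTriangle.isCoveredBy_of_mem (hP : IsArcFamily n k P) (hkn : k < n)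
    (h : IsMinimalTriangle n k P x y z) (hzx : z = x + n) (hzy : z = y + k)
    (hwindow : P y (x + k)) : IsCoveredBy n k P (extremalArcs n k y) := by
  intro i j hij
  obtain ⟨q, hq⟩ := h.isCoveredBy_representatives hP hkn i j hij
  rcases mem_representatives.1 hq with hearly | hy | hz | hx
  · obtain ⟨hsub, hPq, hqx⟩ := mem_earlyArcs.1 hearly
    rw [mem_subarcs] at hsub
    simp only at hsub hPq hqx
    exact (hP.false_of_conflict hkn (y := y) hPq hwindow (by omega) (by omega) (by omega)
      (by omega) (by omega) (by omega)).elim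
  · refine ⟨q, mem_extremalArcs.2 (Or.inl ?_)⟩
    rw [show y + 2 * k - n = x + k by omega]
    exact (mem_arcsIn.1 hy).1
  · rw [mem_subarcs] at hz
    refine ⟨q, mem_extremalArcs.2 (Or.inr (Or.inl ?_))⟩
    rw [Prod.mk.injEq]
    omega
  · refine ⟨q + 1, mem_extremalArcs.2 (Or.inr (Or.inr ?_))⟩
    rw [Prod.mk.injEq, add_one_mul]
    omega

theorem IsMinimalTriangle.isCoveredBy_of_early_mem (hP : IsArcFamily n k P) (hkn : k < n)
    (h : IsMinimalTriangle n k P x y z) (hzx : z = x + n) (hzy : z = y + k)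
    (hearly : P (y - k) x) : IsCoveredBy n k P (extremalArcs n k (y - k)) := by
  intro i j hij
  have hxk := h.le_left_add
  obtain ⟨q, hq⟩ := h.isCoveredBy_representatives hP hkn i j hij
  refine ⟨q, mem_extremalArcs.2 ?_⟩
  simp only [Prod.mk.injEq, mem_subarcs]
  rcases mem_representatives.1 hq with he | hy | hz | hx
  · have hsub := (mem_earlyArcs.1 he).1
    rw [mem_subarcs] at hsub
    omega
  · obtain ⟨hsub, hPq⟩ := mem_arcsIn.1 hy
    rw [mem_subarcs] at hsub
    simp only at hsub hPq
    refine Or.inr (Or.inl ?_)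
    by_contra hne
    exact hP.false_of_conflict hkn (y := y) hearly hPq (by omega) (by omega) (by omega)
      (by omega) (by omega) (by omega)
  · rw [mem_subarcs] at hz
    omega
  · omega

theorem IsMinimalTriangle.mem_or_early_mem (hP : IsArcFamily n k P) (hkn : k < n)
    (h32 : ¬ (n = 3 ∧ k = 2)) (h : IsMinimalTriangle n k P x y z) (hzx : z = x + n)
    (hzy : z = y + k)
    (hfull : arcsIn P y (x + k) ∪ (earlyArcs n k P x y z).image (conflictingArc k x y) =
      subarcs y (x + k)) :
    P y (x + k) ∨ P (y - k) x := by
  have hxk := h.le_left_add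
  have harc : ∀ {i j}, y ≤ i → i ≤ j → j ≤ x + k →
      P i j ∨ ∃ v u, y - k ≤ v ∧ v ≤ u ∧ u ≤ x ∧ P v u ∧ conflictingArc k x y (v, u) = (i, j) := by
    intro i j hyi hij hjx
    have hmem := hfull.ge (mem_subarcs (p := (i, j)).2 ⟨hyi, hij, hjx⟩)
    rcases Finset.mem_union.1 hmem with hP | himage
    · exact Or.inl (mem_arcsIn.1 hP).2
    · obtain ⟨⟨v, u⟩, hvu, heq⟩ := Finset.mem_image.1 himage
      obtain ⟨hsub, hPvu, -⟩ := mem_earlyArcs.1 hvu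
      rw [mem_subarcs] at hsub
      exact Or.inr ⟨v, u, by omega, hsub.2.1, by omega, hPvu, heq⟩
  rcases harc le_rfl hxk le_rfl with hPy | ⟨v, u, hv, hvu, hux, hPvu, heq⟩
  · exact Or.inl hPy
  have hvu_eq : v = y - k ∧ u = x - 1 := by
    simp only [conflictingArc] at heq
    split_ifs at heq <;> rw [Prod.mk.injEq] at heq <;> omega
  obtain ⟨rfl, rfl⟩ := hvu_eq
  rcases harc (i := y + 1) (by omega) le_rfl (by omega) with
    hPy | ⟨v', u', hv', hvu', hux', hPvu', heq'⟩
  · exact (hP.false_of_conflict hkn (y := y) hPvu hPy (by omega) (by omega) (by omega)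
      (by omega) (by omega) (by omega)).elim
  · have hvu'_eq : v' = y - k ∧ u' = x := by
      simp only [conflictingArc] at heq'
      split_ifs at heq' <;> rw [Prod.mk.injEq] at heq' <;> omega
    obtain ⟨rfl, rfl⟩ := hvu'_eq
    exact Or.inr hPvu'

theorem IsMinimalTriangle.exists_isCoveredBy_extremalArcs (hP : IsArcFamily n k P) (hkn : k < n)
    (h32 : ¬ (n = 3 ∧ k = 2)) (h : IsMinimalTriangle n k P x y z)
    (heq : 2 * ((representatives n k P x y z).card : ℤ) =
      4 + (2 * k - n + 1) * (2 * k - n + 2)) :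
    ∃ l, IsCoveredBy n k P (extremalArcs n k l) := by
  obtain ⟨hzx, hzy, hfull⟩ := h.eq_of_two_mul_card_representatives_eq hP hkn heq
  rcases h.mem_or_early_mem hP hkn h32 hzx hzy hfull with hwindow | hearly
  · exact ⟨y, h.isCoveredBy_of_mem hP hkn hzx hzy hwindow⟩
  · exact ⟨y - k, h.isCoveredBy_of_early_mem hP hkn hzx hzy hearly⟩

end Counting

variable {n k : ℕ} {S : Set (CritPair (Crown n k))}

theorem a_le_b_iff {i j : ZMod (n + k)} : (a i : Crown n k) ≤ b j ↔ ¬ InInterval n k i j := Iff.rfl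

theorem a_lt_b_iff {i j : ZMod (n + k)} : (a i : Crown n k) < b j ↔ ¬ InInterval n k i j :=
  ⟨fun h => h.le, fun h => lt_of_le_of_ne h (by simp)⟩

theorem not_lt_a {x : Crown n k} {i : ZMod (n + k)} : ¬ x < a i := fun h => by
  cases x with
  | a j => exact h.ne (congrArg a (show j = i from h.le))
  | b j => exact h.le

theorem not_b_lt {x : Crown n k} {i : ZMod (n + k)} : ¬ b i < x := fun h => by
  cases x with
  | a j => exact h.le
  | b j => exact h.ne (congrArg b (show i = j from h.le))

theorem finite_crown [NeZero (n + k)] : Finite (Crown n k) := by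
  refine Finite.of_surjective (Sum.elim a b : ZMod (n + k) ⊕ ZMod (n + k) → Crown n k) ?_
  rintro (i | i)
  · exact ⟨Sum.inl i, rfl⟩
  · exact ⟨Sum.inr i, rfl⟩

section Interval

theorem inInterval_self (i : ZMod (n + k)) : InInterval n k i i := ⟨0, Nat.zero_le _, by simp⟩

theorem inInterval_neg_neg {i j : ZMod (n + k)} : InInterval n k (-j) (-i) ↔ InInterval n k i j :=
  exists_congr fun _ => and_congr_right fun _ =>
    ⟨fun h => by linear_combination h, fun h => by linear_combination h⟩

theorem inInterval_intCast_left_iff {i : ℤ} {y : ZMod (n + k)} :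
    InInterval n k i y ↔ ∃ j : ℤ, (j : ZMod (n + k)) = y ∧ i ≤ j ∧ j ≤ i + k := by
  constructor
  · rintro ⟨t, ht, rfl⟩
    exact ⟨i + t, by push_cast; rfl, by omega, by omega⟩
  · rintro ⟨j, rfl, hij, hji⟩
    obtain ⟨t, rfl⟩ := Int.le.dest hij
    exact ⟨t, by omega, by push_cast; rfl⟩

theorem inInterval_intCast_right_iff {x : ZMod (n + k)} {j : ℤ} :
    InInterval n k x j ↔ ∃ i : ℤ, (i : ZMod (n + k)) = x ∧ i ≤ j ∧ j ≤ i + k := by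
  constructor
  · rintro ⟨t, ht, h⟩
    exact ⟨j - t, by push_cast; rw [h]; ring, by omega, by omega⟩
  · rintro ⟨i, rfl, hij, hji⟩
    exact inInterval_intCast_left_iff.2 ⟨j, rfl, hij, hji⟩

theorem inInterval_intCast_iff {i j : ℤ} (hij : i < j + n) (hji : j < i + (n + k)) :
    InInterval n k i j ↔ i ≤ j ∧ j ≤ i + k := by
  refine inInterval_intCast_left_iff.trans ⟨?_, fun h => ⟨j, rfl, h⟩⟩
  rintro ⟨l, hlj, hil, hli⟩
  obtain rfl := eq_of_intCast_zmod_eq hlj (by omega) (by omega)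
  exact ⟨hil, hli⟩

theorem not_inInterval_add_succ (hn : 1 < n) (i : ZMod (n + k)) :
    ¬ InInterval n k i (i + (k + 1 : ℕ)) := by
  obtain ⟨i, rfl⟩ := ZMod.intCast_surjective i
  rw [← Int.cast_natCast, ← Int.cast_add, inInterval_intCast_iff] <;> omega

theorem eq_of_forall_inInterval (hn : 1 < n) {i j : ZMod (n + k)}
    (h : ∀ l, InInterval n k i l → InInterval n k j l) : i = j := by
  obtain ⟨s, hsk, rfl⟩ := h i (inInterval_self i)
  rcases Nat.eq_zero_or_pos s with rfl | hs
  · simp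
  · refine absurd (h _ ⟨k + 1 - s, by omega, ?_⟩) (not_inInterval_add_succ hn j)
    rw [add_assoc, ← Nat.cast_add, Nat.add_sub_cancel' (by omega)]

theorem inInterval_of_le_of_le (hkn : k < n) {i j l : ℤ} (hij : i ≤ j) (hjl : j ≤ l)
    (hli : l ≤ i + k) {y : ZMod (n + k)} (hi : InInterval n k i y) (hl : InInterval n k l y) :
    InInterval n k j y := by
  obtain ⟨y, rfl, hiy, hyi⟩ := inInterval_intCast_left_iff.1 hi
  rw [inInterval_intCast_iff (by omega) (by omega)] at hl ⊢
  omega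

theorem inInterval_median (hkn : k < n) {c x₁ x₂ x₃ : ZMod (n + k)} (h₁ : InInterval n k x₁ c)
    (h₂ : InInterval n k x₂ c) (h₃ : InInterval n k x₃ c) :
    (∀ y, InInterval n k x₂ y → InInterval n k x₃ y → InInterval n k x₁ y) ∨
      (∀ y, InInterval n k x₁ y → InInterval n k x₃ y → InInterval n k x₂ y) ∨
      (∀ y, InInterval n k x₁ y → InInterval n k x₂ y → InInterval n k x₃ y) := by
  obtain ⟨c, rfl⟩ := ZMod.intCast_surjective c
  obtain ⟨i₁, rfl, hi₁c, hci₁⟩ := inInterval_intCast_right_iff.1 h₁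
  obtain ⟨i₂, rfl, hi₂c, hci₂⟩ := inInterval_intCast_right_iff.1 h₂
  obtain ⟨i₃, rfl, hi₃c, hci₃⟩ := inInterval_intCast_right_iff.1 h₃
  rcases le_total i₁ i₂ with h₁₂ | h₂₁ <;> rcases le_total i₂ i₃ with h₂₃ | h₃₂ <;>
    rcases le_total i₁ i₃ with h₁₃ | h₃₁
  · exact Or.inr (Or.inl fun y hy₁ hy₃ => inInterval_of_le_of_le hkn h₁₂ h₂₃ (by omega) hy₁ hy₃)
  · exact Or.inr (Or.inl fun y hy₁ hy₃ => inInterval_of_le_of_le hkn h₁₂ h₂₃ (by omega) hy₁ hy₃)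
  · exact Or.inr (Or.inr fun y hy₁ hy₂ => inInterval_of_le_of_le hkn h₁₃ h₃₂ (by omega) hy₁ hy₂)
  · exact Or.inl fun y hy₂ hy₃ => inInterval_of_le_of_le hkn h₃₁ h₁₂ (by omega) hy₃ hy₂
  · exact Or.inl fun y hy₂ hy₃ => inInterval_of_le_of_le hkn h₂₁ h₁₃ (by omega) hy₂ hy₃
  · exact Or.inr (Or.inr fun y hy₁ hy₂ => inInterval_of_le_of_le hkn h₂₃ h₃₁ (by omega) hy₂ hy₁)
  · exact Or.inr (Or.inl fun y hy₁ hy₃ => inInterval_of_le_of_le hkn h₃₂ h₂₁ (by omega) hy₃ hy₁)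
  · exact Or.inr (Or.inl fun y hy₁ hy₃ => inInterval_of_le_of_le hkn h₃₂ h₂₁ (by omega) hy₃ hy₁)

end Interval

section CriticalPairs

theorem isCriticalPair_a_b {i j : ZMod (n + k)} (h : InInterval n k i j) :
    IsCriticalPair (a i : Crown n k) (b j) :=
  ⟨⟨fun h' => a_le_b_iff.1 h' h, fun h' => h'⟩, fun _ h' => absurd h' not_lt_a,
    fun _ h' => absurd h' not_b_lt⟩

theorem exists_of_isCriticalPair (hn : 1 < n) {x y : Crown n k} (h : IsCriticalPair x y) :
    ∃ i j, x = a i ∧ y = b j ∧ InInterval n k i j := by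
  obtain ⟨⟨hxy, -⟩, hbelow, habove⟩ := h
  cases x with
  | a i =>
    cases y with
    | b j => exact ⟨i, j, rfl, rfl, not_not.1 hxy⟩
    | a j =>
      refine absurd (eq_of_forall_inInterval hn fun l hl => ?_) hxy
      by_contra hjl
      exact a_lt_b_iff.1 (habove (b l) (a_lt_b_iff.2 hjl)) hl
  | b i =>
    cases y with
    | a j =>
      refine (not_lt_a (hbelow (a (i - ((k + 1 : ℕ) : ZMod (n + k)))) (a_lt_b_iff.2 ?_))).elim
      simpa only [sub_add_cancel] using
        not_inInterval_add_succ hn (i - ((k + 1 : ℕ) : ZMod (n + k)))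
    | b j =>
      have hneg : -j = -i := eq_of_forall_inInterval hn fun l hl => by
        rw [← neg_neg l, inInterval_neg_neg] at hl ⊢
        by_contra hli
        exact a_lt_b_iff.1 (hbelow (a (-l)) (a_lt_b_iff.2 hli)) hl
      exact absurd (neg_injective hneg).symm hxy

theorem exists_of_mem_image_val (hn : 1 < n) {p : Crown n k × Crown n k}
    (hp : p ∈ Subtype.val '' S) : ∃ i j, p = (a i, b j) ∧ InInterval n k i j := by
  obtain ⟨v, -, rfl⟩ := hp
  obtain ⟨i, j, hi, hj, hij⟩ := exists_of_isCriticalPair hn v.2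
  exact ⟨i, j, Prod.ext hi hj, hij⟩

theorem not_le_of_le (hn : 1 < n) (hS : (graph n k).IsIndepSet S) {p q : Crown n k × Crown n k}
    (hp : p ∈ Subtype.val '' S) (hq : q ∈ Subtype.val '' S) (hpq : p.1 ≤ q.2) :
    ¬ q.1 ≤ p.2 := by
  intro hqp
  obtain ⟨i, j, hi, -⟩ := exists_of_mem_image_val hn hp
  obtain ⟨i', j', hi', -⟩ := exists_of_mem_image_val hn hq
  obtain ⟨v, hv, rfl⟩ := hp
  obtain ⟨w, hw, rfl⟩ := hq
  have hvw : v ≠ w := fun h => v.2.1.1 (hpq.trans_eq (congrArg (·.1.2) h.symm))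
  exact hS hv hw hvw
    ⟨lt_of_le_of_ne hpq (by simp [hi, hi']), lt_of_le_of_ne hqp (by simp [hi, hi'])⟩

theorem exists_shortcut (hkn : k < n) (hn : 1 < n) (hS : (graph n k).IsIndepSet S)
    (hcycle : ∀ p q r, AlternatingStep (Subtype.val '' S) p q →
      AlternatingStep (Subtype.val '' S) q r → ¬ AlternatingStep (Subtype.val '' S) r p)
    {p q r s : Crown n k × Crown n k} (hpq : AlternatingStep (Subtype.val '' S) p q)
    (hqr : AlternatingStep (Subtype.val '' S) q r) (hrs : AlternatingStep (Subtype.val '' S) r s) :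
    AlternatingStep (Subtype.val '' S) p r ∨ AlternatingStep (Subtype.val '' S) q s ∨
      AlternatingStep (Subtype.val '' S) p s := by
  by_contra! hshort
  obtain ⟨i₁, j₁, rfl, h₁₁⟩ := exists_of_mem_image_val hn hpq.1
  obtain ⟨i₂, j₂, rfl, h₂₂⟩ := exists_of_mem_image_val hn hqr.1
  obtain ⟨i₃, j₃, rfl, h₃₃⟩ := exists_of_mem_image_val hn hrs.1
  obtain ⟨i₄, j₄, rfl, -⟩ := exists_of_mem_image_val hn hrs.2.1
  have h₁₃ : InInterval n k i₁ j₃ := not_not.1 fun h => hshort.1 ⟨hpq.1, hrs.1, h⟩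
  have h₂₄ : InInterval n k i₂ j₄ := not_not.1 fun h => hshort.2.1 ⟨hqr.1, hrs.2.1, h⟩
  have h₁₄ : InInterval n k i₁ j₄ := not_not.1 fun h => hshort.2.2 ⟨hpq.1, hrs.2.1, h⟩
  have h₂₁ : InInterval n k i₂ j₁ := not_not.1 (not_le_of_le hn hS hpq.1 hpq.2.1 hpq.2.2)
  have h₃₂ : InInterval n k i₃ j₂ := not_not.1 (not_le_of_le hn hS hqr.1 hqr.2.1 hqr.2.2)
  have h₃₁ : InInterval n k i₃ j₁ := not_not.1 fun h => hcycle _ _ _ hpq hqr ⟨hrs.1, hpq.1, h⟩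
  rcases inInterval_median hkn h₁₁ h₂₁ h₃₁ with h | h | h
  · exact hpq.2.2 (h _ h₂₂ h₃₂)
  · exact hqr.2.2 (h _ h₁₃ h₃₃)
  · exact hrs.2.2 (h _ h₁₄ h₂₄)

theorem IsINR.exists_three_cycle (hkn : k < n) (hn : 1 < n) (hS : IsINR S) : ∃ p q r,
    AlternatingStep (Subtype.val '' S) p q ∧ AlternatingStep (Subtype.val '' S) q r ∧
      AlternatingStep (Subtype.val '' S) r p := by
  obtain ⟨hindep, hrev⟩ := hS
  by_contra! hcycle
  refine hrev (isReversible_of_forall_not_transGen fun p hp => ?_)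
  have two_steps := exists_two_steps_of_transGen (r := AlternatingStep (Subtype.val '' S))
    (exists_shortcut hkn hn hindep hcycle) hp
  rcases two_steps with hpp | ⟨q, hpq, hqp⟩
  · exact not_le_of_le hn hindep hpp.1 hpp.1 hpp.2.2 hpp.2.2
  · exact not_le_of_le hn hindep hpq.1 hpq.2.1 hpq.2.2 hqp.2.2

end CriticalPairs

section Arcs

/-- The pair `(a_i, b_j)` for an arc `[i, j]` of the integers, the universal cover of the circle
`ℤ/(n+k)`. -/
def arcPair (n k : ℕ) (p : ℤ × ℤ) : Crown n k × Crown n k := (a p.1, b p.2)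

/-- The arcs `[i, j]` on the integers that represent the pairs `(a_i, b_j)` of `S`. -/
def arcs (S : Set (CritPair (Crown n k))) (i j : ℤ) : Prop :=
  i ≤ j ∧ j ≤ i + k ∧ arcPair n k (i, j) ∈ Subtype.val '' S

theorem arcPair_add_mul (i j q : ℤ) :
    arcPair n k (i + q * (n + k), j + q * (n + k)) = arcPair n k (i, j) := by
  have : (n : ZMod (n + k)) + k = 0 := by exact_mod_cast ZMod.natCast_self (n + k)
  simp [arcPair, this]

theorem arcPair_eq_arcPair_iff {p q : ℤ × ℤ} : arcPair n k p = arcPair n k q ↔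
    (p.1 : ZMod (n + k)) = q.1 ∧ (p.2 : ZMod (n + k)) = q.2 := by
  rw [arcPair, arcPair, Prod.mk.injEq, a.injEq, b.injEq]

theorem exists_shift_of_arcPair_eq (hn : 0 < n) {i j i' j' : ℤ} (hij : i ≤ j) (hji : j ≤ i + k)
    (hij' : i' ≤ j') (hji' : j' ≤ i' + k) (h : arcPair n k (i, j) = arcPair n k (i', j')) :
    ∃ q : ℤ, i' = i + q * (n + k) ∧ j' = j + q * (n + k) := by
  obtain ⟨q, hq⟩ := intCast_zmod_eq_iff.1 (arcPair_eq_arcPair_iff.1 h).1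
  push_cast at hq
  rw [← arcPair_add_mul i j q] at h
  have hj := eq_of_intCast_zmod_eq (arcPair_eq_arcPair_iff.1 h).2
  push_cast at hj
  exact ⟨q, hq, (hj (by omega) (by omega)).symm⟩

theorem exists_arcs (hn : 1 < n) {p : Crown n k × Crown n k} (hp : p ∈ Subtype.val '' S) (l : ℤ) :
    ∃ i j, arcs S i j ∧ arcPair n k (i, j) = p ∧ l ≤ i ∧ i < l + (n + k) := by
  have : NeZero (n + k) := ⟨by omega⟩
  obtain ⟨x, y, rfl, hxy⟩ := exists_of_mem_image_val hn hp
  obtain ⟨i, rfl, hli, hil⟩ := exists_intCast_zmod_eq l x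
  obtain ⟨j, rfl, hij, hji⟩ := inInterval_intCast_left_iff.1 hxy
  exact ⟨i, j, ⟨hij, hji, hp⟩, rfl, hli, by exact_mod_cast hil⟩

theorem inInterval_or_inInterval (hn : 1 < n) (hS : (graph n k).IsIndepSet S) {i i' j j' : ℤ}
    (hi : arcs S i i') (hj : arcs S j j') : InInterval n k i j' ∨ InInterval n k j i' := by
  by_contra! h
  exact not_le_of_le hn hS hi.2.2 hj.2.2 h.1 h.2

theorem isArcFamily_arcs (hkn : k < n) (hn : 1 < n) (hS : (graph n k).IsIndepSet S) :
    IsArcFamily n k (arcs S) where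
  le h := h.1
  periodic {i j} := by
    have := arcPair_add_mul (n := n) (k := k) i j 1
    rw [one_mul] at this
    exact and_congr (by omega) (and_congr (by omega) (by rw [this]))
  near {i i' j j'} hi hj hij hjk := by
    have := hi.1
    have := hi.2.1
    have := hj.1
    have := hj.2.1
    rcases inInterval_or_inInterval hn hS hi hj with h | h <;>
      rw [inInterval_intCast_iff (by omega) (by omega)] at h <;> omega
  far {i i' j j'} hi hj hij hjn := by
    have := hi.1
    have := hi.2.1
    have := hj.1
    have := hj.2.1
    rcases inInterval_or_inInterval hn hS hi hj with h | h <;>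
      rw [inInterval_intCast_iff (by omega) (by omega)] at h <;> omega

theorem exists_arcs_of_le (hkn : k < n) (hn : 1 < n) (hS : (graph n k).IsIndepSet S) {i i' : ℤ}
    (hi : arcs S i i') {q : Crown n k × Crown n k} (hq : q ∈ Subtype.val '' S) (h : a i ≤ q.2) :
    ∃ j j', arcs S j j' ∧ arcPair n k (j, j') = q ∧
      ((i < j ∧ j ≤ i + k ∧ j ≤ i' ∧ i + k < j') ∨ (j < i ∧ i ≤ j + k ∧ j' < i ∧ i' ≤ j + k)) := by
  have hP := isArcFamily_arcs hkn hn hS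
  obtain ⟨j, j', hj, rfl, hij, hji⟩ := exists_arcs hn hq i
  have := hj.1
  have := hj.2.1
  have outside : ∀ q : ℤ, ¬ (i ≤ j' + q * (n + k) ∧ j' + q * (n + k) ≤ i + k) := fun q hq =>
    h (inInterval_intCast_left_iff.2 ⟨j' + q * (n + k),
      (arcPair_eq_arcPair_iff.1 (arcPair_add_mul j j' q)).2, hq⟩)
  rcases le_or_gt j (i + k) with hjk | hjk
  · have := outside 0
    have := hP.near hi hj (by omega) hjk
    exact ⟨j, j', hj, rfl, Or.inl (by omega)⟩
  · have hjn : i + n ≤ j := not_lt.1 (hP.far hi hj hjk)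
    have := outside (-1)
    have hj₁ := (hP.add_mul_iff (-1)).2 hj
    have := hP.near hj₁ hi (by omega) (by omega)
    exact ⟨_, _, hj₁, arcPair_add_mul j j' (-1), Or.inr (by omega)⟩

end Arcs

section Triangles

theorem isIndepSet_image_map (f : Crown n k ≃o Crown n k) (hS : (graph n k).IsIndepSet S) :
    (graph n k).IsIndepSet (CritPair.map f '' S) := by
  rintro _ ⟨v, hv, rfl⟩ _ ⟨w, hw, rfl⟩ hne ⟨hvw, hwv⟩
  exact hS hv hw (fun h => hne (h ▸ rfl)) ⟨f.lt_iff_lt.1 hvw, f.lt_iff_lt.1 hwv⟩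

theorem arcs_image_reflection {i j : ℤ} (h : arcs S i j) :
    arcs (CritPair.map reflection '' S) (-i) (k - j) := by
  obtain ⟨hij, hji, v, hv, hv'⟩ := h
  refine ⟨by omega, by omega, CritPair.map reflection v, ⟨v, hv, rfl⟩, ?_⟩
  change (reflection v.1.1, reflection v.1.2) = _
  rw [hv', arcPair, arcPair, Int.cast_neg, Int.cast_sub, Int.cast_natCast]
  rfl

theorem IsINR.exists_isTriangle (hkn : k < n) (hn : 1 < n) (hS : IsINR S) :
    (∃ x y z, IsTriangle n k (arcs S) x y z) ∨
      ∃ x y z, IsTriangle n k (arcs (CritPair.map reflection '' S)) x y z := by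
  obtain ⟨p, q, r, hpq, hqr, hrp⟩ := hS.exists_three_cycle hkn hn
  obtain ⟨i₁, j₁, h₁, rfl, -⟩ := exists_arcs hn hpq.1 0
  obtain ⟨i₂, j₂, h₂, rfl, step₁⟩ := exists_arcs_of_le hkn hn hS.1 h₁ hpq.2.1 hpq.2.2
  obtain ⟨i₃, j₃, h₃, rfl, step₂⟩ := exists_arcs_of_le hkn hn hS.1 h₂ hqr.2.1 hqr.2.2
  obtain ⟨i₄, j₄, h₄, h₄₁, step₃⟩ := exists_arcs_of_le hkn hn hS.1 h₃ hrp.2.1 hrp.2.2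
  obtain ⟨q, hi, hj⟩ :=
    exists_shift_of_arcPair_eq (by omega) h₁.1 h₁.2.1 h₄.1 h₄.2.1 h₄₁.symm
  have hq : q = -1 ∨ q = 0 ∨ q = 1 := by
    have : -(3 * k) ≤ q * (n + k) := by omega
    have : q * (n + k) ≤ 3 * k := by omega
    have : -2 < q := by nlinarith
    have : q < 2 := by nlinarith
    omega
  -- The total length of the steps being a multiple of `n + k`, they all have the same direction.
  rcases hq with rfl | rfl | rfl <;> rcases step₁ with step₁ | step₁ <;>
    rcases step₂ with step₂ | step₂ <;> rcases step₃ with step₃ | step₃ <;> try omega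
  · exact Or.inl ⟨i₄, i₃, i₂, ⟨_, _, _, h₄, h₃, h₂, by omega⟩, by omega, by omega, by omega⟩
  · exact Or.inr ⟨-i₄, -i₃, -i₂, ⟨_, _, _, arcs_image_reflection h₄, arcs_image_reflection h₃,
      arcs_image_reflection h₂, by omega⟩, by omega, by omega, by omega⟩

end Triangles

section ExtremalSet

theorem downSet_insert (c : ZMod (n + k) × ZMod (n + k)) (C : Set (ZMod (n + k) × ZMod (n + k))) :
    downSet (insert c C) = downSet {c} ∪ downSet C := by
  ext v
  simp only [downSet, Set.mem_ofPred_eq, Set.exists_mem_insert, Set.mem_union, ← exists_or,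
    ← and_or_left, Set.mem_singleton_iff, exists_eq_left]

theorem image_val_downSet_singleton (hn : 0 < n) {l u : ℤ} (hlu : l ≤ u) (hul : u ≤ l + k) :
    Subtype.val '' downSet {((l : ZMod (n + k)), (u : ZMod (n + k)))} =
      arcPair n k '' subarcs l u := by
  have : NeZero (n + k) := ⟨by omega⟩
  ext p
  constructor
  · rintro ⟨v, ⟨x, y, hv, -, rfl, h⟩, rfl⟩
    obtain ⟨i, j, rfl, rfl, hij⟩ := (val_sub_le_val_sub_iff hlu (by push_cast; omega)).1 h
    exact ⟨(i, j), mem_subarcs.2 hij, hv.symm⟩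
  · rintro ⟨⟨i, j⟩, hij, rfl⟩
    replace hij := mem_subarcs.1 hij
    have critical : IsCriticalPair (a i : Crown n k) (b j) :=
      isCriticalPair_a_b (inInterval_intCast_left_iff.2 ⟨j, rfl, hij.2.1, by omega⟩)
    exact ⟨⟨_, critical⟩, ⟨i, j, rfl, _, rfl,
      (val_sub_le_val_sub_iff hlu (by push_cast; omega)).2 ⟨i, j, rfl, rfl, hij⟩⟩, rfl⟩

theorem image_val_extremalSet (hkn : k < n) (hnk : n ≤ 2 * k) :
    Subtype.val '' extremalSet n k = arcPair n k '' extremalArcs n k 1 := by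
  have h₁ := image_val_downSet_singleton (n := n) (k := k) (l := 1) (u := 1 + 2 * k - n)
    (by omega) (by omega) (by omega)
  have h₂ := image_val_downSet_singleton (n := n) (k := k) (l := 1 + k) (u := 1 + k)
    (by omega) (by omega) (by omega)
  have h₃ := image_val_downSet_singleton (n := n) (k := k) (l := 1 + 2 * k) (u := 1 + 2 * k)
    (by omega) (by omega) (by omega)
  have hu : ((2 * k + 1 - n : ℕ) : ZMod (n + k)) = ((1 + 2 * k - n : ℤ) : ZMod (n + k)) := by
    rw [← Int.cast_natCast]
    congr 1
    omega
  have hk₁ : ((k + 1 : ℕ) : ZMod (n + k)) = ((1 + k : ℤ) : ZMod (n + k)) := by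
    push_cast; ring
  have hk₂ : ((2 * k + 1 : ℕ) : ZMod (n + k)) = ((1 + 2 * k : ℤ) : ZMod (n + k)) := by
    push_cast; ring
  rw [Int.cast_one] at h₁
  rw [extremalSet, downSet_insert, downSet_insert, Set.image_union, Set.image_union, hu, hk₁, hk₂,
    h₁, h₂, h₃, subarcs_self, subarcs_self, extremalArcs, ← Set.image_union, ← Set.image_union,
    Finset.coe_union, Finset.coe_pair, Finset.coe_singleton, Finset.coe_singleton,
    Set.singleton_union]

theorem injOn_arcPair_extremalArcs (hkn : k < n) (hnk : n ≤ 2 * k) (y : ℤ) :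
    Set.InjOn (arcPair n k) (extremalArcs n k y) := by
  rintro ⟨i, j⟩ hp ⟨i', j'⟩ hq h
  obtain ⟨hi, hj⟩ := arcPair_eq_arcPair_iff.1 h
  simp only [Finset.mem_coe, mem_extremalArcs, mem_subarcs, Prod.mk.injEq] at hp hq
  exact Prod.ext (eq_of_intCast_zmod_eq hi (by push_cast; omega) (by push_cast; omega))
    (eq_of_intCast_zmod_eq hj (by push_cast; omega) (by push_cast; omega))

theorem two_mul_ncard_extremalSet (hkn : k < n) (hnk : n ≤ 2 * k) :
    2 * ((extremalSet n k).ncard : ℤ) = 4 + (2 * k - n + 1) * (2 * k - n + 2) := by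
  rw [← Set.ncard_image_of_injective _ Subtype.val_injective, image_val_extremalSet hkn hnk,
    (injOn_arcPair_extremalArcs hkn hnk 1).ncard_image, Set.ncard_coe_finset,
    two_mul_card_extremalArcs (by omega) (by omega)]

theorem isIndepSet_extremalSet (hkn : k < n) (hnk : n ≤ 2 * k) :
    (graph n k).IsIndepSet (extremalSet n k) := by
  rintro v hv w hw - ⟨hvw, hwv⟩
  have mem : ∀ {v}, v ∈ extremalSet n k → v.1 ∈ arcPair n k '' extremalArcs n k 1 := fun hv =>
    image_val_extremalSet hkn hnk ▸ Set.mem_image_of_mem _ hv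
  obtain ⟨⟨i, i'⟩, hi, hiv⟩ := mem hv
  obtain ⟨⟨j, j'⟩, hj, hjw⟩ := mem hw
  rw [← hiv, ← hjw] at hvw hwv
  have outside : ∀ {i j' : ℤ}, (a i : Crown n k) < b j' →
      ¬ (i ≤ j' ∧ j' ≤ i + k) ∧ ¬ (i ≤ j' + (n + k) ∧ j' + (n + k) ≤ i + k) := fun {i j'} h =>
    ⟨fun h' => a_lt_b_iff.1 h (inInterval_intCast_left_iff.2 ⟨j', rfl, h'⟩),
      fun h' => a_lt_b_iff.1 h (inInterval_intCast_left_iff.2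
        ⟨j' + (n + k), intCast_zmod_eq_iff.2 ⟨-1, by push_cast; ring⟩, h'⟩)⟩
  have := outside hvw
  have := outside hwv
  simp only [Finset.mem_coe, mem_extremalArcs, mem_subarcs, Prod.mk.injEq] at hi hj
  omega

theorem not_isReversible_extremalSet (hkn : k < n) (hnk : n ≤ 2 * k) :
    ¬ IsReversible (Subtype.val '' extremalSet n k) := by
  intro hrev
  have mem : ∀ i : ℤ, i = 1 ∨ i = 1 + k ∨ i = 1 + 2 * k →
      arcPair n k (i, i) ∈ Subtype.val '' extremalSet n k := fun i hi => by
    rw [image_val_extremalSet hkn hnk]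
    refine Set.mem_image_of_mem _ (Finset.mem_coe.2 (mem_extremalArcs.2 ?_))
    simp only [mem_subarcs, Prod.mk.injEq]
    omega
  have step : ∀ {i j : ℤ}, (i = 1 ∨ i = 1 + k ∨ i = 1 + 2 * k) →
      (j = 1 ∨ j = 1 + k ∨ j = 1 + 2 * k) → i < j + n → ¬ (i ≤ j ∧ j ≤ i + k) →
      AlternatingStep (Subtype.val '' extremalSet n k) (arcPair n k (i, i)) (arcPair n k (j, j)) :=
    fun hi hj hlt hout => ⟨mem _ hi, mem _ hj,
      a_le_b_iff.2 (mt (inInterval_intCast_iff hlt (by omega)).1 hout)⟩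
  have h₁₃ := step (i := 1) (j := 1 + 2 * k) (by omega) (by omega) (by omega) (by omega)
  have h₃₂ := step (i := 1 + 2 * k) (j := 1 + k) (by omega) (by omega) (by omega) (by omega)
  have h₂₁ := step (i := 1 + k) (j := 1) (by omega) (by omega) (by omega) (by omega)
  exact not_transGen_of_isReversible hrev _ (((Relation.TransGen.single h₁₃).tail h₃₂).tail h₂₁)

theorem isINR_extremalSet (hkn : k < n) (hnk : n ≤ 2 * k) : IsINR (extremalSet n k) :=
  ⟨isIndepSet_extremalSet hkn hnk, not_isReversible_extremalSet hkn hnk⟩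

end ExtremalSet

section Bound

variable {x y z : ℤ}

theorem image_val_subset_of_isCoveredBy (hn : 1 < n) {A : Finset (ℤ × ℤ)}
    (hA : IsCoveredBy n k (arcs S) A) : Subtype.val '' S ⊆ arcPair n k '' A := by
  intro p hp
  obtain ⟨i, j, hij, rfl, -⟩ := exists_arcs hn hp 0
  obtain ⟨q, hq⟩ := hA i j hij
  exact ⟨_, hq, arcPair_add_mul i j q⟩

theorem ncard_le_card_of_isCoveredBy (hn : 1 < n) {A : Finset (ℤ × ℤ)}
    (hA : IsCoveredBy n k (arcs S) A) : S.ncard ≤ A.card := by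
  rw [← Set.ncard_image_of_injective S Subtype.val_injective, ← Set.ncard_coe_finset A]
  exact (Set.ncard_le_ncard (image_val_subset_of_isCoveredBy hn hA)
    (A.finite_toSet.image _)).trans (Set.ncard_image_le A.finite_toSet)

theorem arcPair_image_extremalArcs_subset (hkn : k < n) (hnk : n ≤ 2 * k) (y : ℤ) :
    arcPair n k '' extremalArcs n k y ⊆ Subtype.val ''
      (CritPair.map (rotation ((y - 1 : ℤ) : ZMod (n + k))) '' extremalSet n k) := by
  rintro _ ⟨⟨i, j⟩, hij, rfl⟩
  have hij₁ : arcPair n k (i - (y - 1), j - (y - 1)) ∈ Subtype.val '' extremalSet n k := by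
    rw [image_val_extremalSet hkn hnk]
    refine Set.mem_image_of_mem _ ?_
    simp only [Finset.mem_coe, mem_extremalArcs, mem_subarcs, Prod.mk.injEq] at hij ⊢
    omega
  obtain ⟨v, hv, hvij⟩ := hij₁
  refine ⟨_, Set.mem_image_of_mem _ hv, ?_⟩
  change (rotation _ v.1.1, rotation _ v.1.2) = _
  rw [hvij]
  change (a _, b _) = arcPair n k (i, j)
  rw [arcPair, ← Int.cast_add, ← Int.cast_add, sub_add_cancel, sub_add_cancel]

theorem IsTriangle.two_mul_ncard_le (hkn : k < n) (hnk : n ≤ 2 * k)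
    (hS : (graph n k).IsIndepSet S) (h : IsTriangle n k (arcs S) x y z) :
    2 * (S.ncard : ℤ) ≤ 4 + (2 * k - n + 1) * (2 * k - n + 2) := by
  have hP := isArcFamily_arcs hkn (by omega) hS
  obtain ⟨x, y, z, h⟩ := exists_isMinimalTriangle hP h
  have hcard := ncard_le_card_of_isCoveredBy (by omega)
    (h.isCoveredBy_representatives hP (Nat.cast_lt.2 hkn))
  have := h.two_mul_card_representatives_le hP (Nat.cast_lt.2 hkn)
  omega

theorem IsTriangle.exists_eq_image_rotation (hkn : k < n) (hnk : n ≤ 2 * k)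
    (hS : (graph n k).IsIndepSet S) (h : IsTriangle n k (arcs S) x y z) (h32 : (n, k) ≠ (3, 2))
    (heq : S.ncard = (extremalSet n k).ncard) :
    ∃ j, S = CritPair.map (rotation j) '' extremalSet n k := by
  have : NeZero (n + k) := ⟨by omega⟩
  have := finite_crown (n := n) (k := k)
  have hP := isArcFamily_arcs hkn (by omega) hS
  obtain ⟨x, y, z, h⟩ := exists_isMinimalTriangle hP h
  have hcard := ncard_le_card_of_isCoveredBy (by omega)
    (h.isCoveredBy_representatives hP (Nat.cast_lt.2 hkn))
  have hcard_le := h.two_mul_card_representatives_le hP (Nat.cast_lt.2 hkn)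
  have hcard_eq := two_mul_ncard_extremalSet hkn hnk
  obtain ⟨l, hl⟩ := h.exists_isCoveredBy_extremalArcs hP (Nat.cast_lt.2 hkn)
    (fun hnk₃₂ => h32 (Prod.ext (by omega) (by omega))) (by omega)
  refine ⟨((l - 1 : ℤ) : ZMod (n + k)), Set.eq_of_subset_of_ncard_le ?_ ?_⟩
  · rw [← Set.image_subset_image_iff Subtype.val_injective]
    exact (image_val_subset_of_isCoveredBy (by omega) hl).trans
      (arcPair_image_extremalArcs_subset hkn hnk l)
  · rw [Set.ncard_image_of_injective _ (CritPair.map_injective _), heq]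

theorem IsINR.two_mul_ncard_le (hkn : k < n) (hnk : n ≤ 2 * k) (hS : IsINR S) :
    2 * (S.ncard : ℤ) ≤ 4 + (2 * k - n + 1) * (2 * k - n + 2) := by
  rcases hS.exists_isTriangle hkn (by omega) with ⟨x, y, z, h⟩ | ⟨x, y, z, h⟩
  · exact h.two_mul_ncard_le hkn hnk hS.1
  · rw [← Set.ncard_image_of_injective S (CritPair.map_injective reflection)]
    exact h.two_mul_ncard_le hkn hnk (isIndepSet_image_map _ hS.1)

theorem map_reflection_map_reflection (v : CritPair (Crown n k)) :
    CritPair.map reflection (CritPair.map reflection v) = v :=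
  Subtype.ext (Prod.ext (reflection.left_inv _) (reflection.left_inv _))

theorem reflection_rotation (j : ZMod (n + k)) (x : Crown n k) :
    reflection (rotation j x) = rotation (-j) (reflection x) := by
  cases x with
  | a i => exact congrArg a (by ring)
  | b i => exact congrArg b (by ring)

theorem map_reflection_map_rotation (j : ZMod (n + k)) (v : CritPair (Crown n k)) :
    CritPair.map reflection (CritPair.map (rotation j) v) =
      CritPair.map (rotation (-j)) (CritPair.map reflection v) :=
  Subtype.ext (Prod.ext (reflection_rotation j _) (reflection_rotation j _))

theorem IsINR.exists_eq_image_rotation (hkn : k < n) (hnk : n ≤ 2 * k) (hS : IsINR S)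
    (h32 : (n, k) ≠ (3, 2)) (heq : S.ncard = (extremalSet n k).ncard) :
    ∃ j, S = CritPair.map (rotation j) '' extremalSet n k ∨
      S = CritPair.map (rotation j) '' (CritPair.map reflection '' extremalSet n k) := by
  rcases hS.exists_isTriangle hkn (by omega) with ⟨x, y, z, h⟩ | ⟨x, y, z, h⟩
  · obtain ⟨j, hj⟩ := h.exists_eq_image_rotation hkn hnk hS.1 h32 heq
    exact ⟨j, Or.inl hj⟩
  · obtain ⟨j, hj⟩ := h.exists_eq_image_rotation hkn hnk (isIndepSet_image_map _ hS.1) h32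
      ((Set.ncard_image_of_injective S (CritPair.map_injective _)).trans heq)
    refine ⟨-j, Or.inr ?_⟩
    have hSj := congrArg (CritPair.map reflection '' ·) hj
    simpa only [Set.image_image, map_reflection_map_reflection, map_reflection_map_rotation,
      Set.image_id'] using hSj

theorem two_mul_natCast_bound (hnk : n ≤ 2 * k) :
    2 * ((2 + (2 * k + 2 - n) * (2 * k + 1 - n) / 2 : ℕ) : ℤ) =
      4 + (2 * k - n + 1) * (2 * k - n + 2) := by
  obtain ⟨c, hc⟩ : ∃ c, 2 * k = n + c := ⟨2 * k - n, by omega⟩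
  rw [show 2 * k + 2 - n = c + 1 + 1 by omega, show 2 * k + 1 - n = c + 1 by omega,
    show (2 * k - n : ℤ) = c by omega, mul_comm (c + 1 + 1)]
  have := Nat.div_two_mul_two_of_even (Nat.even_mul_succ_self (c + 1))
  zify at this
  push_cast
  linarith

end Bound

end Crown

theorem theorem1p4 (n k : ℕ) (hn : 3 ≤ n) (hkn : k < n) (hnk : n ≤ 2 * k) :
    (∀ S : Set (CritPair (Crown n k)), Crown.IsINR S →
      S.ncard ≤ 2 + (2 * k + 2 - n) * (2 * k + 1 - n) / 2) ∧
    (Crown.IsINR (Crown.extremalSet n k) ∧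
      (Crown.extremalSet n k).ncard = 2 + (2 * k + 2 - n) * (2 * k + 1 - n) / 2) ∧
    ((n, k) ≠ (3, 2) →
      ∀ S : Set (CritPair (Crown n k)), Crown.IsINR S →
        S.ncard = 2 + (2 * k + 2 - n) * (2 * k + 1 - n) / 2 →
        ∃ j : ZMod (n + k),
          S = CritPair.map (Crown.rotation j) '' Crown.extremalSet n k ∨
          S = CritPair.map (Crown.rotation j) ''
            (CritPair.map Crown.reflection '' Crown.extremalSet n k)) := by
  have card_eq : (Crown.extremalSet n k).ncard =
      2 + (2 * k + 2 - n) * (2 * k + 1 - n) / 2 := by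
    have := Crown.two_mul_ncard_extremalSet hkn hnk
    have := Crown.two_mul_natCast_bound hnk
    omega
  refine ⟨fun S hS => ?_, ⟨Crown.isINR_extremalSet hkn hnk, card_eq⟩, fun h32 S hS hcard =>
    hS.exists_eq_image_rotation hkn hnk h32 (hcard.trans card_eq.symm)⟩
  have := hS.two_mul_ncard_le hkn hnk
  have := Crown.two_mul_natCast_bound hnk
  omega
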